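/- Let $q$ be a prime power and let $C\subseteq\mathbb{F}_q^{q+1}$ be an MDS $[q+1,2,q]_q$ code, i.e. a $2$-dimensional $\mathbb{F}_q$-linear subspace with minimum Hamming distance $q$ (so that the Singleton bound $d\le n-k+1$ is attained). For $v\in\mathbb{F}_q^{q+1}$ write $d(v,C)=\min_{x\in C}d(v,x)$, where $d$ is the Hamming distance, let $B_{v,t}$ be the number of $x\in C$ with $d(v,x)=t$, and let $\rho=\max_{v}d(v,C)$ be the covering radius of $C$. The code $C$ is called completely regular (CR) if $B_{v,t}$ depends only on $t$ and $d(v,C)$, and uniformly packed in the wide sense (UPWS) if there are rational numbers $\beta_0,\dots,\beta_\rho$ such that $\sum_{i=0}^{\rho}\beta_iB_{x,i}=1$ for every $x\in\mathbb{F}_q^{q+1}$. Then: (i) If $q$ is odd, then $C$ is UPWS if and only if $q=3$, and $C$ is CR if and only if $q=3$. (ii) If $q$ is even, then $C$ is UPWS. If $q=4$, then $C$ is CR. If $q=8$, then $C$ is not CR. -/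

import Mathlib

/-- The distance `d(v, C)` from a word `v` to a (nonempty) code `C`. -/
noncomputable def distToCode {F : Type*} [DecidableEq F] {n : ℕ}
    (v : Fin n → F) (C : Set (Fin n → F)) : ℕ :=
  sInf {t : ℕ | ∃ x ∈ C, hammingDist v x = t}

/-- The minimum Hamming distance between distinct codewords of `C`. -/
noncomputable def minDistance {F : Type*} [DecidableEq F] {n : ℕ}
    (C : Set (Fin n → F)) : ℕ :=
  sInf {t : ℕ | ∃ x ∈ C, ∃ y ∈ C, x ≠ y ∧ hammingDist x y = t}

/-- The covering radius: the maximum of `d(v, C)` over all words `v`. -/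
noncomputable def coveringRadius {F : Type*} [Fintype F] [DecidableEq F] {n : ℕ}
    (C : Set (Fin n → F)) : ℕ :=
  Finset.univ.sup fun v : Fin n → F => distToCode v C

/-- `B_{v,t}`: the number of codewords at distance exactly `t` from `v`. -/
noncomputable def numAtDist {F : Type*} [DecidableEq F] {n : ℕ}
    (C : Set (Fin n → F)) (v : Fin n → F) (t : ℕ) : ℕ :=
  {x : Fin n → F | x ∈ C ∧ hammingDist v x = t}.ncard

/-- `C` is completely regular: `B_{v,t}` depends only on `t` and `d(v, C)`. -/
def IsCompletelyRegular {F : Type*} [DecidableEq F] {n : ℕ}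
    (C : Set (Fin n → F)) : Prop :=
  ∀ u v : Fin n → F, distToCode u C = distToCode v C →
    ∀ t : ℕ, t ≤ n → numAtDist C u t = numAtDist C v t

/-- `C` is uniformly packed in the wide sense: there are rational packing coefficients
`β 0, …, β ρ`, with `ρ` the covering radius, such that `∑ i ≤ ρ, β i * B_{x,i} = 1`
for every word `x`. -/
def IsUPWS {F : Type*} [Fintype F] [DecidableEq F] {n : ℕ}
    (C : Set (Fin n → F)) : Prop :=
  ∃ β : ℕ → ℚ, ∀ x : Fin n → F,
    ∑ i ∈ Finset.range (coveringRadius C + 1), β i * (numAtDist C x i : ℚ) = 1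

/-- `C` is a linear `[n, k, d]` code: a `k`-dimensional subspace of `F ^ n` with
minimum distance `d`. -/
def IsLinearCode {F : Type*} [Field F] [DecidableEq F] {n : ℕ}
    (C : Submodule F (Fin n → F)) (k d : ℕ) : Prop :=
  Module.finrank F C = k ∧ minDistance (C : Set (Fin n → F)) = d

/-- `C` is maximum distance separable: it attains the Singleton bound `d ≤ n - k + 1`. -/
def IsMDS {F : Type*} [Field F] [DecidableEq F] {n : ℕ}
    (C : Submodule F (Fin n → F)) : Prop :=
  minDistance (C : Set (Fin n → F)) + Module.finrank F C = n + 1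

/-! For a word `v`, let `a` be its number of agreements with a codeword. Any two coordinates form an
information set, so over all codewords `∑ a = q(q+1)` and `∑ a² = 2q(q+1)`, hence `∑ a(a-1) =
q(q+1)` (`sum_agreement`, `sum_agreement_sq`). The weight `a(a-1)` vanishes for `a ≤ 1`, so it gives
packing coefficients whenever the covering radius is at least `q-1`. For even `q` it is: square
roots give a conic word agreeing at most twice with every codeword.

For odd `q` no such word exists, by parity, and a quadratic word shows that the radius is exactly
`q-2`. For `q ≥ 5`, two words at distance 3 from the code differ in their number of codewords at
distance `q-2` but not below (`exists_numAtDist_lt`). This refutes complete regularity. If `q` is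
odd it also forces `β (q-2) = 0`, which fails at a word at distance `q-2`.

For `q = 3, 4`, the triangle inequality and a count for weight 2 fix the distribution below `q-1`;
the moments fix the rest. -/

/-- The number of coordinates in which two words agree. -/
def agreement {F : Type*} [DecidableEq F] {n : ℕ} (v c : Fin n → F) : ℕ := (Finset.univ.filter fun i => v i = c i).card

lemma hammingDist_add_agreement {F : Type*} [DecidableEq F] {n : ℕ} (v c : Fin n → F) :
    hammingDist v c + agreement v c = n := by
  have := Finset.card_filter_add_card_filter_not (s := (Finset.univ : Finset (Fin n)))
    (fun i => v i = c i)
  simp only [Finset.card_univ, Fintype.card_fin] at this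
  rw [add_comm] at this
  exact this

/-! ### Interpolation and moments of the agreement numbers. -/

section TwoDimensional

variable {F : Type*} [Field F] [Fintype F] [DecidableEq F] {q : ℕ}

/-- The `[q+1, 2, q]` codes, described by dimension and nonzero weights. -/
structure IsTwoDimMDS (C : Submodule F (Fin (q + 1) → F)) : Prop where
  card_eq : Fintype.card F = q
  finrank_eq : Module.finrank F C = 2
  le_norm : ∀ c ∈ C, c ≠ 0 → q ≤ hammingNorm c

lemma IsLinearCode.isTwoDimMDS {C : Submodule F (Fin (q + 1) → F)}
    (hq : Fintype.card F = q) (hC : IsLinearCode C 2 q) : IsTwoDimMDS C := by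
  refine ⟨hq, hC.1, fun c hc h0 => ?_⟩
  conv_lhs => rw [← hC.2]
  exact Nat.sInf_le ⟨c, hc, 0, C.zero_mem, h0, hammingDist_zero_right c⟩

namespace IsTwoDimMDS

variable {C : Submodule F (Fin (q + 1) → F)}

lemma two_le (hC : IsTwoDimMDS C) : 2 ≤ q := by
  rw [← hC.card_eq]; exact Fintype.one_lt_card

lemma agreement_le_one (hC : IsTwoDimMDS C) {c d : Fin (q + 1) → F} (hc : c ∈ C) (hd : d ∈ C)
    (h : c ≠ d) : agreement c d ≤ 1 := by
  have h1 := hC.le_norm (c - d) (C.sub_mem hc hd) (sub_ne_zero.2 h)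
  rw [sub_eq_neg_add, ← hammingDist_eq_hammingNorm, hammingDist_comm] at h1
  have := hammingDist_add_agreement c d
  omega

lemma eq_of_eq_of_eq (hC : IsTwoDimMDS C) {c d : Fin (q + 1) → F} (hc : c ∈ C) (hd : d ∈ C)
    {i j : Fin (q + 1)} (hij : i ≠ j) (hi : c i = d i) (hj : c j = d j) : c = d := by
  by_contra h
  have h1 := hC.agreement_le_one hc hd h
  have : 1 < agreement c d :=
    Finset.one_lt_card.2 ⟨i, by simpa using hi, j, by simpa using hj, hij⟩
  omega

/-- Distinct codewords agree at most once, so evaluation at two coordinates is injective between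
spaces of dimension two. -/
lemma bijective_eval (hC : IsTwoDimMDS C) {i j : Fin (q + 1)} (hij : i ≠ j) :
    Function.Bijective fun c : C => ((c : Fin (q + 1) → F) i, (c : Fin (q + 1) → F) j) := by
  let f : C →ₗ[F] F × F :=
    ((LinearMap.proj i).prod (LinearMap.proj j)).comp C.subtype
  have hinj : Function.Injective f := fun c d h =>
    Subtype.ext (hC.eq_of_eq_of_eq c.2 d.2 hij (congrArg Prod.fst h) (congrArg Prod.snd h))
  have : FiniteDimensional F C := inferInstance
  exact ⟨hinj, (LinearMap.injective_iff_surjective_of_finrank_eq_finrank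
    (by rw [hC.finrank_eq]; simp)).1 hinj⟩

lemma exists_interpolation (hC : IsTwoDimMDS C) {i j : Fin (q + 1)} (hij : i ≠ j) (s t : F) :
    ∃ c ∈ C, c i = s ∧ c j = t := by
  obtain ⟨c, hc⟩ := (hC.bijective_eval hij).2 (s, t)
  exact ⟨c, c.2, congrArg Prod.fst hc, congrArg Prod.snd hc⟩

/-- A basis of the code adapted to three coordinates `i`, `j`, `k`. -/
lemma exists_basis (hC : IsTwoDimMDS C) {i j k : Fin (q + 1)} (hij : i ≠ j) (hik : i ≠ k)
    (hjk : j ≠ k) : ∃ e ∈ C, ∃ g ∈ C, e j = 0 ∧ g i = 0 ∧ e k = 1 ∧ g k = 1 ∧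
      (∀ l, e l = 0 → l = j) ∧ (∀ l, g l = 0 → l = i) ∧
      (∀ c ∈ C, ∃ x y : F, c = x • e + y • g) := by
  obtain ⟨e, he, hej, hek⟩ := hC.exists_interpolation hjk 0 1
  obtain ⟨g, hg, hgi, hgk⟩ := hC.exists_interpolation hik 0 1
  have he0 : ∀ l, e l = 0 → l = j := fun l hl => by
    by_contra h
    have := hC.eq_of_eq_of_eq he C.zero_mem h (by simpa using hl) (by simpa using hej)
    simp [this] at hek
  have hg0 : ∀ l, g l = 0 → l = i := fun l hl => by
    by_contra h
    have := hC.eq_of_eq_of_eq hg C.zero_mem h (by simpa using hl) (by simpa using hgi)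
    simp [this] at hgk
  refine ⟨e, he, g, hg, hej, hgi, hek, hgk, he0, hg0, fun c hc => ⟨c i / e i, c j / g j, ?_⟩⟩
  have hei : e i ≠ 0 := fun h => hij (he0 i h)
  have hgj : g j ≠ 0 := fun h => hij (hg0 j h).symm
  refine hC.eq_of_eq_of_eq hc (C.add_mem (C.smul_mem _ he) (C.smul_mem _ hg)) hij ?_ ?_
  · simp [hgi, hei]
  · simp [hej, hgj]

lemma exists_three (hC : IsTwoDimMDS C) : ∃ i j k : Fin (q + 1), i ≠ j ∧ i ≠ k ∧ j ≠ k := by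
  have := hC.two_le
  refine ⟨⟨0, by omega⟩, ⟨1, by omega⟩, ⟨2, by omega⟩, ?_, ?_, ?_⟩ <;> simp

open Classical in
lemma card_filter_eval_eval (hC : IsTwoDimMDS C) {i j : Fin (q + 1)} (hij : i ≠ j) (s t : F) :
    (Finset.univ.filter fun c : C =>
      s = (c : Fin (q + 1) → F) i ∧ t = (c : Fin (q + 1) → F) j).card = 1 := by
  obtain ⟨c, hc, hi, hj⟩ := hC.exists_interpolation hij s t
  rw [Finset.card_eq_one]
  refine ⟨⟨c, hc⟩, ?_⟩
  ext d
  simp only [Finset.mem_filter, Finset.mem_univ, true_and, Finset.mem_singleton]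
  constructor
  · rintro ⟨h1, h2⟩
    exact Subtype.ext (hC.eq_of_eq_of_eq d.2 hc hij (h1.symm.trans hi.symm)
      (h2.symm.trans hj.symm))
  · rintro rfl
    exact ⟨hi.symm, hj.symm⟩

open Classical in
lemma card_filter_eval (hC : IsTwoDimMDS C) (i : Fin (q + 1)) (s : F) :
    (Finset.univ.filter fun c : C => s = (c : Fin (q + 1) → F) i).card = q := by
  have : Nontrivial (Fin (q + 1)) := Fin.nontrivial_iff_two_le.2 (by have := hC.two_le; omega)
  obtain ⟨j, hj⟩ := exists_ne i
  rw [Finset.card_eq_sum_card_fiberwise (t := (Finset.univ : Finset F))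
    (f := fun c : C => (c : Fin (q + 1) → F) j) (by simp)]
  have : ∀ t : F, ((Finset.univ.filter fun c : C => s = (c : Fin (q + 1) → F) i).filter
      fun c : C => (c : Fin (q + 1) → F) j = t).card = 1 := fun t => by
    rw [Finset.filter_filter]
    refine Eq.trans ?_ (hC.card_filter_eval_eval hj.symm s t)
    congr 1
    ext c
    simp [eq_comm]
  simp [this, hC.card_eq]

open Classical in
lemma card_code (hC : IsTwoDimMDS C) : Fintype.card C = q ^ 2 := by
  rw [Module.card_eq_pow_finrank (K := F), hC.card_eq, hC.finrank_eq]

open Classical in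
lemma sum_agreement (hC : IsTwoDimMDS C) (v : Fin (q + 1) → F) :
    ∑ c : C, agreement v c = (q + 1) * q := by
  simp only [agreement, Finset.card_filter]
  rw [Finset.sum_comm]
  simp only [← Finset.card_filter, hC.card_filter_eval]
  simp

open Classical in
-- Count ordered pairs of agreeing coordinates: for fixed `i`, the diagonal pair contributes `q`
-- codewords and each of the `q` others contributes one.
lemma sum_agreement_sq (hC : IsTwoDimMDS C) (v : Fin (q + 1) → F) :
    ∑ c : C, agreement v c ^ 2 = 2 * ((q + 1) * q) := by
  have h1 : ∀ c : C, agreement v c ^ 2 = ∑ i, ∑ j,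
      if v i = (c : Fin (q + 1) → F) i ∧ v j = (c : Fin (q + 1) → F) j then 1 else 0 := fun c => by
    simp only [agreement, Finset.card_filter, sq, Finset.sum_mul_sum]
    refine Finset.sum_congr rfl fun i _ => Finset.sum_congr rfl fun j _ => ?_
    rw [ite_and, ite_mul, one_mul, zero_mul]
  simp only [h1]
  rw [Finset.sum_comm]
  have h2 : ∀ i : Fin (q + 1), ∑ c : C, ∑ j,
      (if v i = (c : Fin (q + 1) → F) i ∧ v j = (c : Fin (q + 1) → F) j then 1 else 0)
        = 2 * q := fun i => by
    rw [Finset.sum_comm, ← Finset.add_sum_erase _ _ (Finset.mem_univ i)]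
    have h3 : ∀ j ∈ Finset.univ.erase i, (∑ c : C,
        if v i = (c : Fin (q + 1) → F) i ∧ v j = (c : Fin (q + 1) → F) j then 1 else 0) = 1 := by
      intro j hj
      rw [← Finset.card_filter]
      exact hC.card_filter_eval_eval (Finset.ne_of_mem_erase hj).symm _ _
    rw [Finset.sum_congr rfl h3]
    simp only [and_self, ← Finset.card_filter, hC.card_filter_eval]
    simp
    omega
  rw [Finset.sum_congr rfl fun i _ => h2 i]
  simp
  ring

/-- All nonzero weights equal `q`: the `q² - 1` nonzero codewords have at most one zero each, and
the first moment says that they have `q² - 1` zeros together. -/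
lemma agreement_zero (hC : IsTwoDimMDS C) {c : Fin (q + 1) → F} (hc : c ∈ C) (h0 : c ≠ 0) :
    agreement 0 c = 1 := by
  classical
  refine le_antisymm (hC.agreement_le_one C.zero_mem hc h0.symm) ?_
  by_contra hlt
  have hs := hC.sum_agreement 0
  rw [← Finset.add_sum_erase _ _ (Finset.mem_univ (0 : C))] at hs
  have hlt' : ∑ d ∈ (Finset.univ : Finset C).erase 0, agreement 0 (d : Fin (q + 1) → F)
      < ∑ d ∈ (Finset.univ : Finset C).erase 0, 1 := by
    refine Finset.sum_lt_sum (fun d hd => hC.agreement_le_one C.zero_mem d.2 ?_)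
      ⟨⟨c, hc⟩, ?_, by simpa using hlt⟩
    · simpa [eq_comm] using hd
    · simpa using h0
  have h00 : agreement 0 ((0 : C) : Fin (q + 1) → F) = q + 1 := by simp [agreement]
  have hq := hC.two_le
  simp only [Finset.sum_const, Finset.card_erase_of_mem (Finset.mem_univ _), Finset.card_univ,
    hC.card_code, smul_eq_mul, mul_one] at hlt'
  have : q ^ 2 - 1 + (q + 1) = (q + 1) * q := by
    have : 1 ≤ q ^ 2 := Nat.one_le_pow _ _ (by omega)
    zify [this]; ring
  omega

/-- The distance from a word supported on `S` to a nonzero codeword. -/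
lemma hammingDist_add_card (hC : IsTwoDimMDS C) {c : Fin (q + 1) → F} (hc : c ∈ C) (h0 : c ≠ 0)
    (v : Fin (q + 1) → F) (S : Finset (Fin (q + 1))) (hS : ∀ i ∉ S, v i = 0) :
    hammingDist v c + (S.filter fun i => v i = c i).card
      = q + (S.filter fun i => c i = 0).card := by
  have h1 := hammingDist_add_agreement v c
  have h2 := hC.agreement_zero hc h0
  have split : ∀ w : Fin (q + 1) → F, agreement w c = (S.filter fun i => w i = c i).card +
      (Sᶜ.filter fun i => w i = c i).card := fun w => by
    rw [agreement, ← Finset.card_union_of_disjoint, ← Finset.filter_union, Finset.union_compl]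
    exact Finset.disjoint_filter_filter disjoint_compl_right
  have h3 : (Sᶜ.filter fun i => v i = c i) = Sᶜ.filter fun i => (0 : Fin (q + 1) → F) i = c i :=
    Finset.filter_congr fun i hi => by rw [hS i (by simpa using hi)]; rfl
  have h4 : (S.filter fun i => c i = 0) = S.filter fun i => (0 : Fin (q + 1) → F) i = c i :=
    Finset.filter_congr fun i _ => eq_comm
  rw [split, h3] at h1
  rw [split] at h2
  rw [h4]
  omega

lemma le_hammingDist (hC : IsTwoDimMDS C) {c d : Fin (q + 1) → F} (hc : c ∈ C) (hd : d ∈ C)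
    (h : c ≠ d) (v : Fin (q + 1) → F) : q ≤ hammingDist v c + hammingDist v d := by
  have h1 := hC.agreement_le_one hc hd h
  have h2 := hammingDist_add_agreement c d
  have h3 := hammingDist_triangle c v d
  rw [hammingDist_comm c v] at h3
  omega

end IsTwoDimMDS

end TwoDimensional

/-! ### Distance distributions and translation by codewords. -/

section Distances

variable {F : Type*} [DecidableEq F] {n : ℕ}

lemma distToCode_le {C : Set (Fin n → F)} {c : Fin n → F} (hc : c ∈ C) (v : Fin n → F) :
    distToCode v C ≤ hammingDist v c :=
  Nat.sInf_le ⟨c, hc, rfl⟩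

lemma exists_hammingDist_eq_distToCode {C : Set (Fin n → F)} (hC : C.Nonempty) (v : Fin n → F) :
    ∃ c ∈ C, hammingDist v c = distToCode v C := by
  obtain ⟨c, hc⟩ := hC
  exact Nat.sInf_mem (s := {t : ℕ | ∃ x ∈ C, hammingDist v x = t}) ⟨_, c, hc, rfl⟩

lemma distToCode_le_coveringRadius [Fintype F] (C : Set (Fin n → F)) (v : Fin n → F) :
    distToCode v C ≤ coveringRadius C :=
  Finset.le_sup (f := fun v : Fin n → F => distToCode v C) (Finset.mem_univ v)

variable [Fintype F]

open Classical in
lemma numAtDist_eq_card (C : Set (Fin n → F)) (v : Fin n → F) (t : ℕ) :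
    numAtDist C v t = (Finset.univ.filter fun c : C => hammingDist v (c : Fin n → F) = t).card := by
  rw [numAtDist, ← Finset.card_map (Function.Embedding.subtype _), ← Set.ncard_coe_finset]
  congr 1
  ext x
  simp [and_comm]

lemma numAtDist_eq_zero_of_lt {C : Set (Fin n → F)} {v : Fin n → F} {t : ℕ}
    (h : t < distToCode v C) : numAtDist C v t = 0 := by
  rw [numAtDist, Set.ncard_eq_zero]
  refine Set.eq_empty_of_forall_notMem fun x ⟨hx, hd⟩ => ?_
  have := distToCode_le hx v
  omega

open Classical in
lemma sum_hammingDist (C : Set (Fin n → F)) (v : Fin n → F) {R : Type*} [CommSemiring R]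
    (g : ℕ → R) :
    ∑ c : C, g (hammingDist v (c : Fin n → F))
      = ∑ t ∈ Finset.range (n + 1), g t * (numAtDist C v t : R) := by
  rw [← Finset.sum_fiberwise_of_maps_to (s := Finset.univ) (t := Finset.range (n + 1))
    (g := fun c : C => hammingDist v (c : Fin n → F))]
  · refine Finset.sum_congr rfl fun t _ => ?_
    rw [numAtDist_eq_card, Finset.sum_congr rfl (g := fun _ => g t)]
    · rw [Finset.sum_const, nsmul_eq_mul, mul_comm]
    · intro c hc
      rw [(Finset.mem_filter.1 hc).2]
  · intro c _
    have := hammingDist_le_card_fintype (x := v) (y := (c : Fin n → F))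
    simp only [Fintype.card_fin] at this
    exact Finset.mem_range.2 (by omega)

end Distances

section DistancesInCodes

variable {F : Type*} [Field F] [DecidableEq F] {n : ℕ}

lemma hammingDist_sub_sub (v x c : Fin n → F) : hammingDist (v - c) (x - c) = hammingDist v x := by
  simp [hammingDist]

lemma numAtDist_sub {C : Submodule F (Fin n → F)} {c : Fin n → F} (hc : c ∈ C) (v : Fin n → F)
    (t : ℕ) : numAtDist (C : Set (Fin n → F)) (v - c) t = numAtDist (C : Set (Fin n → F)) v t := by
  rw [numAtDist, numAtDist, eq_comm]
  refine Set.ncard_congr (fun x _ => x - c) ?_ ?_ ?_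
  · rintro x ⟨hx, hd⟩
    exact ⟨C.sub_mem hx hc, by rw [hammingDist_sub_sub, hd]⟩
  · intro x y _ _ h
    exact sub_left_injective h
  · rintro x ⟨hx, hd⟩
    refine ⟨x + c, ⟨C.add_mem hx hc, ?_⟩, by simp⟩
    rw [← hd, ← hammingDist_sub_sub v (x + c) c, add_sub_cancel_right]

/-- A word can be translated so that the zero word is a closest codeword. -/
lemma exists_translate (C : Submodule F (Fin n → F)) (v : Fin n → F) :
    ∃ w : Fin n → F, hammingNorm w = distToCode v (C : Set (Fin n → F)) ∧
      ∀ t, numAtDist (C : Set (Fin n → F)) w t = numAtDist (C : Set (Fin n → F)) v t := by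
  obtain ⟨c, hc, hd⟩ := exists_hammingDist_eq_distToCode (C := (C : Set (Fin n → F)))
    ⟨0, C.zero_mem⟩ v
  refine ⟨v - c, ?_, numAtDist_sub hc v⟩
  rw [← hd, ← hammingDist_sub_sub v c c, sub_self, hammingDist_zero_right]

lemma le_distToCode_of_agreement_le (C : Submodule F (Fin n → F)) {v : Fin n → F} {m : ℕ}
    (h : ∀ c ∈ C, agreement v c ≤ m) :
    n - m ≤ distToCode v (C : Set (Fin n → F)) := by
  obtain ⟨c, hc, hd⟩ := exists_hammingDist_eq_distToCode (C := (C : Set (Fin n → F)))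
    ⟨0, C.zero_mem⟩ v
  have := hammingDist_add_agreement v c
  have := h c hc
  omega

end DistancesInCodes

/-! ### Moments in terms of `numAtDist`, and words far from the code. -/

namespace IsTwoDimMDS

variable {F : Type*} [Field F] [Fintype F] [DecidableEq F] {q : ℕ}
  {C : Submodule F (Fin (q + 1) → F)}

lemma sum_numAtDist (hC : IsTwoDimMDS C) (v : Fin (q + 1) → F) :
    ∑ t ∈ Finset.range (q + 2), numAtDist (C : Set (Fin (q + 1) → F)) v t = q ^ 2 := by
  classical
  have := sum_hammingDist (C : Set (Fin (q + 1) → F)) v (fun _ => 1)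
  simp only [one_mul, Nat.cast_id] at this
  rw [← this, Finset.sum_const, smul_eq_mul, mul_one, Finset.card_univ, ← hC.card_code]
  rfl

lemma sum_mul_numAtDist (hC : IsTwoDimMDS C) (v : Fin (q + 1) → F) :
    ∑ t ∈ Finset.range (q + 2), (q + 1 - t) * numAtDist (C : Set (Fin (q + 1) → F)) v t
      = (q + 1) * q := by
  classical
  have := sum_hammingDist (C : Set (Fin (q + 1) → F)) v (fun t => q + 1 - t)
  simp only [Nat.cast_id] at this
  rw [← this, ← hC.sum_agreement v]
  refine Finset.sum_congr rfl fun c _ => ?_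
  have := hammingDist_add_agreement v (c : Fin (q + 1) → F)
  omega

lemma sum_sq_mul_numAtDist (hC : IsTwoDimMDS C) (v : Fin (q + 1) → F) :
    ∑ t ∈ Finset.range (q + 2), (q + 1 - t) ^ 2 * numAtDist (C : Set (Fin (q + 1) → F)) v t
      = 2 * ((q + 1) * q) := by
  classical
  have := sum_hammingDist (C : Set (Fin (q + 1) → F)) v (fun t => (q + 1 - t) ^ 2)
  simp only [Nat.cast_id] at this
  rw [← this, ← hC.sum_agreement_sq v]
  refine Finset.sum_congr rfl fun c _ => ?_
  have := hammingDist_add_agreement v (c : Fin (q + 1) → F)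
  congr 1
  omega

/-- A quadratic word, which agrees with every codeword in at most three positions. -/
lemma exists_agreement_le_three (hC : IsTwoDimMDS C) :
    ∃ v : Fin (q + 1) → F, ∀ c ∈ C, agreement v c ≤ 3 := by
  obtain ⟨i, j, k, hij, hik, hjk⟩ := hC.exists_three
  obtain ⟨e, he, g, hg, hej, hgi, hek, hgk, he0, hg0, hspan⟩ := hC.exists_basis hij hik hjk
  -- In the affine coordinate `u = g/e`, after division by `e`, the word is `u²` and a codeword is
  -- `x + y u`. They meet at most twice; the point at infinity `j` can add one agreement.
  refine ⟨fun l => g l ^ 2 / e l, fun c hc => ?_⟩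
  obtain ⟨x, y, rfl⟩ := hspan c hc
  rw [agreement]
  refine le_trans (Nat.sub_le_iff_le_add.1 (Finset.pred_card_le_card_erase (a := j))) ?_
  refine Nat.succ_le_succ (m := 2) ?_
  by_contra! h
  obtain ⟨l, m, p, hl, hm, hp, hlm, hlp, hmp⟩ := Finset.two_lt_card_iff.1 h
  simp only [Finset.mem_erase, Finset.mem_filter, Finset.mem_univ, true_and, Pi.add_apply,
    Pi.smul_apply, smul_eq_mul] at hl hm hp
  have key : ∀ l, l ≠ j ∧ g l ^ 2 / e l = x * e l + y * g l →
      e l ≠ 0 ∧ (g l / e l) ^ 2 = x + y * (g l / e l) := fun l hl => by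
    have h0 : e l ≠ 0 := fun h => hl.1 (he0 l h)
    refine ⟨h0, ?_⟩
    have := hl.2
    field_simp at this ⊢
    linear_combination this
  have ratio : ∀ l m, e l ≠ 0 → e m ≠ 0 → l ≠ m → g l / e l - g m / e m ≠ 0 := by
    intro l m hl hm hlm h
    rw [sub_eq_zero] at h
    have h0 := hC.eq_of_eq_of_eq (C.smul_mem (g l / e l) he) hg hlm (by simp [hl])
      (by rw [h]; simp [hm])
    have := congrFun h0 j
    simp only [Pi.smul_apply, hej, smul_eq_mul, mul_zero] at this
    exact hij (hg0 j this.symm).symm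
  obtain ⟨hl0, hl1⟩ := key l hl
  obtain ⟨hm0, hm1⟩ := key m hm
  obtain ⟨hp0, hp1⟩ := key p hp
  have h1 : g l / e l + g m / e m = y :=
    mul_left_cancel₀ (ratio l m hl0 hm0 hlm) (by linear_combination hl1 - hm1)
  have h2 : g l / e l + g p / e p = y :=
    mul_left_cancel₀ (ratio l p hl0 hp0 hlp) (by linear_combination hl1 - hp1)
  exact ratio m p hm0 hp0 hmp (by linear_combination h1 - h2)

/-- In characteristic two there is a word which agrees with every codeword in at most two
positions. -/
lemma exists_agreement_le_two (hC : IsTwoDimMDS C) (hq : Even q) :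
    ∃ v : Fin (q + 1) → F, ∀ c ∈ C, agreement v c ≤ 2 := by
  have hchar : ringChar F = 2 := by
    by_contra h
    have := FiniteField.odd_card_of_char_ne_two h
    rw [hC.card_eq] at this
    exact absurd hq (Nat.not_even_iff.2 this)
  have : CharP F 2 := ringChar.of_eq hchar
  obtain ⟨i, j, k, hij, hik, hjk⟩ := hC.exists_three
  obtain ⟨e, he, g, hg, hej, hgi, hek, hgk, he0, hg0, hspan⟩ := hC.exists_basis hij hik hjk
  -- The points `(e l, g l, s l)` lie on the conic `s² = e g`, and agreement with a codeword means
  -- lying on the line `s = x e + y g`, which meets it at most twice.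
  choose s hs using fun l => FiniteField.isSquare_of_char_two hchar (e l * g l)
  refine ⟨s, fun c hc => ?_⟩
  obtain ⟨x, y, rfl⟩ := hspan c hc
  rw [agreement]
  by_contra! h
  obtain ⟨l, m, p, hl, hm, hp, hlm, hlp, hmp⟩ := Finset.two_lt_card_iff.1 h
  simp only [Finset.mem_filter, Finset.mem_univ, true_and, Pi.add_apply,
    Pi.smul_apply, smul_eq_mul] at hl hm hp
  have two : (2 : F) = 0 := CharTwo.two_eq_zero
  have key : ∀ l, s l = x * e l + y * g l →
      x ^ 2 * e l ^ 2 + y ^ 2 * g l ^ 2 = e l * g l := fun l hl => by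
    rw [hs, hl]
    linear_combination (- x * y * e l * g l) * two
  have det : ∀ l m, l ≠ m → g l * e m - g m * e l ≠ 0 := by
    intro l m hlm h
    have h0 := hC.eq_of_eq_of_eq (C.smul_mem (g m) he) (C.smul_mem (e m) hg) hlm
      (by simp only [Pi.smul_apply, smul_eq_mul]; linear_combination -h) (by simp [mul_comm])
    have h1 := congrFun h0 j
    have h2 := congrFun h0 i
    simp only [Pi.smul_apply, hej, hgi, smul_eq_mul, mul_zero] at h1 h2
    have hm1 : e m = 0 := (mul_eq_zero.1 h1.symm).resolve_right fun h => hij (hg0 j h).symm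
    have hm2 : g m = 0 := (mul_eq_zero.1 h2).resolve_right fun h => hij (he0 i h)
    exact hij ((hg0 m hm2).symm.trans (he0 m hm1))
  have hl1 := key l hl
  have hm1 := key m hm
  have hp1 := key p hp
  -- Eliminating `x²` between two of the equations leaves the determinant as a common factor, since
  -- in characteristic two squaring is additive.
  have h1 : y ^ 2 * (g l * e m + g m * e l) = e l * e m :=
    mul_left_cancel₀ (det l m hlm) (by linear_combination e m ^ 2 * hl1 - e l ^ 2 * hm1)
  have h2 : y ^ 2 * (g l * e p + g p * e l) = e l * e p :=
    mul_left_cancel₀ (det l p hlp) (by linear_combination e p ^ 2 * hl1 - e l ^ 2 * hp1)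
  have h3 : y ^ 2 * (g m * e p + g p * e m) = e m * e p :=
    mul_left_cancel₀ (det m p hmp) (by linear_combination e p ^ 2 * hm1 - e m ^ 2 * hp1)
  have h4 : e l * (y ^ 2 * (g m * e p - g p * e m)) = 0 := by
    linear_combination e p * h1 - e m * h2
  have h5 : e m * (y ^ 2 * (g l * e p - g p * e l)) = 0 := by
    linear_combination e p * h1 - e l * h3
  have vanish : ∀ l m, l ≠ m → e l = 0 → e m ≠ 0 := fun l m hlm hl hm =>
    hlm ((he0 l hl).trans (he0 m hm).symm)
  by_cases hy : y = 0
  · simp only [hy, ne_eq, OfNat.ofNat_ne_zero, not_false_eq_true, zero_pow, zero_mul] at h1 h2 h3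
    rcases mul_eq_zero.1 h1.symm with h | h
    · exact mul_ne_zero (vanish l m hlm h) (vanish l p hlp h) h3.symm
    · exact mul_ne_zero (vanish m l hlm.symm h) (vanish m p hmp h) h2.symm
  · have hy2 := pow_ne_zero 2 hy
    exact vanish l m hlm
      ((mul_eq_zero.1 h4).resolve_right (mul_ne_zero hy2 (det m p hmp)))
      ((mul_eq_zero.1 h5).resolve_right (mul_ne_zero hy2 (det l p hlp)))

end IsTwoDimMDS

/-! ### Covering radius for odd `q`, and uniform packing for even `q`. -/

namespace IsTwoDimMDS

variable {F : Type*} [Field F] [Fintype F] [DecidableEq F] {q : ℕ}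
  {C : Submodule F (Fin (q + 1) → F)}

/-- With `a ≤ 2`, the identity `∑ a² = 2 ∑ a` forces every `a` to be even. The codewords taking a
value other than `v 0` at coordinate 0 have agreements summing to `q`, one for each remaining
coordinate. -/
lemma even_of_agreement_le_two (hC : IsTwoDimMDS C) {v : Fin (q + 1) → F}
    (hv : ∀ c ∈ C, agreement v c ≤ 2) : Even q := by
  classical
  have hsq : ∀ c : C, agreement v c ^ 2 = 2 * agreement v c := by
    have hle : ∀ c ∈ (Finset.univ : Finset C), agreement v c ^ 2 ≤ 2 * agreement v c :=
      fun c _ => by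
        rw [sq]
        exact Nat.mul_le_mul_right _ (hv c c.2)
    have := (Finset.sum_eq_sum_iff_of_le hle).1
      (by rw [← Finset.mul_sum, hC.sum_agreement_sq, hC.sum_agreement])
    exact fun c => this c (Finset.mem_univ c)
  have heven : ∀ c : C, Even (agreement v c) := fun c => by
    have : Even (agreement v c ^ 2) := by rw [hsq]; exact even_two_mul _
    exact (Nat.even_pow.1 this).1
  obtain ⟨s, hs⟩ := exists_ne (v 0)
  have hsum : ∑ c ∈ Finset.univ.filter (fun c : C => s = (c : Fin (q + 1) → F) 0),
      agreement v c = q := by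
    simp only [agreement, Finset.card_filter]
    rw [Finset.sum_comm, ← Finset.add_sum_erase _ _ (Finset.mem_univ 0),
      Finset.sum_congr rfl (s₁ := Finset.univ.erase 0) (g := fun _ => 1)]
    · rw [Finset.sum_eq_zero]
      · simp
      · intro c hc
        rw [if_neg]
        rw [← (Finset.mem_filter.1 hc).2]
        exact hs.symm
    · intro k hk
      rw [← Finset.card_filter, Finset.filter_filter]
      exact hC.card_filter_eval_eval (Finset.ne_of_mem_erase hk).symm _ _
  rw [← hsum]
  exact Finset.even_sum _ fun c _ => heven c

lemma coveringRadius_le (hC : IsTwoDimMDS C) (hq : Odd q) :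
    coveringRadius (C : Set (Fin (q + 1) → F)) ≤ q - 2 := by
  refine Finset.sup_le fun v _ => ?_
  by_contra! h
  refine Nat.not_even_iff_odd.2 hq (hC.even_of_agreement_le_two (v := v) fun c hc => ?_)
  have h1 := distToCode_le (C := (C : Set (Fin (q + 1) → F))) hc v
  have h2 := hammingDist_add_agreement v c
  omega

lemma coveringRadius_eq (hC : IsTwoDimMDS C) (hq : Odd q) :
    coveringRadius (C : Set (Fin (q + 1) → F)) = q - 2 := by
  refine le_antisymm (hC.coveringRadius_le hq) ?_
  obtain ⟨v, hv⟩ := hC.exists_agreement_le_three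
  exact (le_distToCode_of_agreement_le C hv).trans (distToCode_le_coveringRadius _ v)

lemma isUPWS_of_even (hC : IsTwoDimMDS C) (hq : Even q) :
    IsUPWS (C : Set (Fin (q + 1) → F)) := by
  classical
  have hq0 : (q : ℚ) ≠ 0 := by have := hC.two_le; positivity
  have hq1 : (q : ℚ) + 1 ≠ 0 := by positivity
  obtain ⟨w, hw⟩ := hC.exists_agreement_le_two hq
  have hρ := (le_distToCode_of_agreement_le C hw).trans (distToCode_le_coveringRadius _ w)
  -- This is `a(a-1)/(q(q+1))` with `a = q+1-t`. It vanishes at `t = q` and `t = q+1`, the only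
  -- terms that truncation at the covering radius can lose.
  let β : ℕ → ℚ := fun t => ((q + 1 - t) ^ 2 - (q + 1 - t)) / (q * (q + 1))
  refine ⟨β, fun v => ?_⟩
  have hsum := sum_hammingDist (C : Set (Fin (q + 1) → F)) v β
  have htrunc : ∑ t ∈ Finset.range (coveringRadius (C : Set (Fin (q + 1) → F)) + 1),
      β t * (numAtDist (C : Set (Fin (q + 1) → F)) v t : ℚ) =
      ∑ t ∈ Finset.range (q + 1 + 1), β t * (numAtDist (C : Set (Fin (q + 1) → F)) v t : ℚ) := by
    refine Finset.sum_subset (Finset.range_subset_range.2 (Nat.succ_le_succ ?_)) fun t ht ht' => ?_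
    · refine Finset.sup_le fun u _ => (distToCode_le C.zero_mem u).trans ?_
      simpa using hammingDist_le_card_fintype (x := u) (y := 0)
    · rw [Finset.mem_range] at ht ht'
      have : t = q ∨ t = q + 1 := by omega
      rcases this with rfl | rfl <;> simp [β]
  rw [htrunc, ← hsum]
  have h1 : (∑ c : C, (agreement v c : ℚ)) = (q + 1) * q := mod_cast hC.sum_agreement v
  have h2 : (∑ c : C, (agreement v c : ℚ) ^ 2) = 2 * ((q + 1) * q) :=
    mod_cast hC.sum_agreement_sq v
  have h3 : ∀ c : C, β (hammingDist v (c : Fin (q + 1) → F))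
      = ((agreement v c : ℚ) ^ 2 - agreement v c) / (q * (q + 1)) := fun c => by
    have : (hammingDist v (c : Fin (q + 1) → F) : ℚ) + agreement v c = q + 1 :=
      mod_cast hammingDist_add_agreement v (c : Fin (q + 1) → F)
    simp only [β]
    rw [← this]
    ring
  have h4 : ∑ c : C, ((agreement v c : ℚ) ^ 2 - agreement v c) / (q * (q + 1)) = 1 := by
    rw [← Finset.sum_div, Finset.sum_sub_distrib, h1, h2]
    field_simp
    ring
  rw [← h4]
  exact Finset.sum_congr rfl fun c _ => h3 c

lemma numAtDist_eq_ncard_add (C : Submodule F (Fin (q + 1) → F)) (v : Fin (q + 1) → F) (t : ℕ) :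
    numAtDist (C : Set (Fin (q + 1) → F)) v t =
      {x | x ∈ C ∧ x ≠ 0 ∧ hammingDist v x = t}.ncard + if hammingNorm v = t then 1 else 0 := by
  rw [numAtDist]
  split_ifs with h
  · rw [← Set.ncard_insert_of_notMem (a := 0) (by simp)]
    congr 1
    ext x
    by_cases hx : x = 0
    · simp [hx, h]
    · simp [hx]
  · congr 1
    ext x
    by_cases hx : x = 0
    · simp [hx, h]
    · simp [hx]

/-! ### Words of weight three and the negative results. -/

/-- Distances from a word of weight three to the nonzero codewords, in a basis adapted to its
support. -/
lemma hammingDist_weight_three (hC : IsTwoDimMDS C) {i j k : Fin (q + 1)} (hij : i ≠ j)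
    (hik : i ≠ k) (hjk : j ≠ k) {e g : Fin (q + 1) → F} (he : e ∈ C) (hg : g ∈ C)
    (hej : e j = 0) (hgi : g i = 0) (hek : e k = 1) (hgk : g k = 1) (hei : e i ≠ 0)
    (hgj : g j ≠ 0) {v : Fin (q + 1) → F} {z : F} (hvi : v i = e i) (hvj : v j = - g j)
    (hvk : v k = z) (hv : ∀ l, l ≠ i → l ≠ j → l ≠ k → v l = 0) {x y : F}
    (hxy : x • e + y • g ≠ 0) :
    hammingDist v (x • e + y • g) + ((if x = 1 then 1 else 0) + ((if y = -1 then 1 else 0)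
      + (if z = x + y then 1 else 0))) =
      q + ((if x = 0 then 1 else 0) + ((if y = 0 then 1 else 0)
      + (if x + y = 0 then 1 else 0))) := by
  have h := hC.hammingDist_add_card (C.add_mem (C.smul_mem x he) (C.smul_mem y hg)) hxy v
    {i, j, k} fun l hl => by
      simp only [Finset.mem_insert, Finset.mem_singleton, not_or] at hl
      exact hv l hl.1 hl.2.1 hl.2.2
  have hx1 : e i = x * e i ↔ x = 1 := by
    rw [eq_comm, mul_eq_right₀ hei]
  have hy1 : - g j = y * g j ↔ y = -1 := by
    rw [← neg_one_mul, mul_left_inj' hgj, eq_comm]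
  have hi : i ∉ ({j, k} : Finset (Fin (q + 1))) := by simp [hij, hik]
  have hj : j ∉ ({k} : Finset (Fin (q + 1))) := by simpa using hjk
  rw [Finset.card_filter, Finset.card_filter, Finset.sum_insert hi, Finset.sum_insert hj,
    Finset.sum_singleton, Finset.sum_insert hi, Finset.sum_insert hj, Finset.sum_singleton] at h
  simpa only [Pi.add_apply, Pi.smul_apply, smul_eq_mul, hvi, hvj, hvk, hej, hgi, hek, hgk,
    mul_zero, mul_one, add_zero, zero_add, hx1, hy1, mul_eq_zero, hei, hgj, or_false] using h

/-- Two words at distance three from the code which see different numbers of codewords at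
distance `q - 2`. -/
lemma exists_numAtDist_lt (hC : IsTwoDimMDS C) (hq : 5 ≤ q) :
    ∃ u v : Fin (q + 1) → F,
      distToCode u (C : Set (Fin (q + 1) → F)) = 3 ∧
      distToCode v (C : Set (Fin (q + 1) → F)) = 3 ∧
      (∀ t < q - 2, numAtDist (C : Set (Fin (q + 1) → F)) u t
        = numAtDist (C : Set (Fin (q + 1) → F)) v t) ∧
      numAtDist (C : Set (Fin (q + 1) → F)) u (q - 2)
        < numAtDist (C : Set (Fin (q + 1) → F)) v (q - 2) := by
  obtain ⟨i, j, k, hij, hik, hjk⟩ := hC.exists_three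
  obtain ⟨e, he, g, hg, hej, hgi, hek, hgk, he0, hg0, hspan⟩ := hC.exists_basis hij hik hjk
  have hei : e i ≠ 0 := fun h => hij (he0 i h)
  have hgj : g j ≠ 0 := fun h => hij (hg0 j h).symm
  -- The entries are scaled so that agreement with `x • e + y • g` at `i`, `j`, `k` reads `x = 1`,
  -- `y = -1`, `x + y = z`. Distance `q-2` needs two agreements and no zero of the codeword on the
  -- support. The pair `(1, -1)` vanishes at `k`; the candidates left are `(1, z-1)` and `(z+1,
  -- -1)`.
  let w : F → Fin (q + 1) → F := fun z l =>
    if l = i then e i else if l = j then - g j else if l = k then z else 0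
  have hdist : ∀ z x y : F, x • e + y • g ≠ 0 →
      hammingDist (w z) (x • e + y • g) + ((if x = 1 then 1 else 0) +
        ((if y = -1 then 1 else 0) + (if z = x + y then 1 else 0))) =
      q + ((if x = 0 then 1 else 0) + ((if y = 0 then 1 else 0)
        + (if x + y = 0 then 1 else 0))) := fun z x y hxy =>
    hC.hammingDist_weight_three hij hik hjk he hg hej hgi hek hgk hei hgj (v := w z) (z := z)
      (by simp [w]) (by simp [w, hij.symm]) (by simp [w, hik.symm, hjk.symm])
      (fun l h1 h2 h3 => by simp [w, h1, h2, h3]) hxy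
  have hnorm : ∀ z : F, z ≠ 0 → hammingNorm (w z) = 3 := fun z hz => by
    have : (Finset.univ.filter fun l => w z l ≠ 0) = {i, j, k} := by
      ext l
      simp only [Finset.mem_filter, Finset.mem_univ, true_and, Finset.mem_insert,
        Finset.mem_singleton, w]
      split_ifs <;> simp_all
    rw [hammingNorm, this, Finset.card_eq_three]
    exact ⟨i, j, k, hij, hik, hjk, rfl⟩
  have hge : ∀ z : F, z ≠ 0 → ∀ c ∈ C, c ≠ 0 → q - 2 ≤ hammingDist (w z) c := by
    intro z hz c hc h0
    obtain ⟨x, y, rfl⟩ := hspan c hc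
    have := hdist z x y h0
    by_cases h1 : x = 1 ∧ y = -1
    · rw [if_neg (c := z = x + y) (by rw [h1.1, h1.2]; simpa using hz)] at this
      split_ifs at this <;> omega
    · rw [not_and_or] at h1
      rcases h1 with h1 | h1 <;> rw [if_neg h1] at this <;> split_ifs at this <;> omega
  have hthree : ∀ z : F, z ≠ 0 → distToCode (w z) (C : Set (Fin (q + 1) → F)) = 3 := by
    intro z hz
    have h0 : hammingDist (w z) 0 = 3 := by rw [hammingDist_zero_right, hnorm z hz]
    refine le_antisymm (h0 ▸ distToCode_le C.zero_mem _) ?_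
    obtain ⟨c, hc, hd⟩ := exists_hammingDist_eq_distToCode (C := (C : Set (Fin (q + 1) → F)))
      ⟨0, C.zero_mem⟩ (w z)
    rw [← hd]
    by_cases hc0 : c = 0
    · rw [hc0, h0]
    · exact le_trans (by omega) (hge z hz c hc hc0)
  -- For `z = 1` the candidate `(1, z-1)` has a zero at `j`, so only `(2, -1)` can survive.
  have hone : {x | x ∈ C ∧ x ≠ 0 ∧ hammingDist (w 1) x = q - 2}.ncard ≤ 1 := by
    refine (Set.ncard_le_ncard (t := {(2 : F) • e + (-1 : F) • g}) ?_).trans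
      (Set.ncard_singleton _).le
    rintro c ⟨hc, h0, hd⟩
    obtain ⟨x, y, rfl⟩ := hspan c hc
    have := hdist 1 x y h0
    rw [hd] at this
    have hne : ¬(x = 1 ∧ (1 : F) = x + y) := fun h => by
      have hy : y = 0 := by linear_combination -h.2 - h.1
      rw [if_pos hy, if_neg (c := y = -1) (by rw [hy]; simp)] at this
      split_ifs at this <;> omega
    have hne' : ¬(x = 1 ∧ y = -1) := fun h => by
      have hxy : x + y = 0 := by linear_combination h.1 + h.2
      rw [if_pos hxy, if_neg (c := 1 = x + y) (by rw [hxy]; simp)] at this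
      split_ifs at this <;> omega
    have hx : ¬ x = 1 := fun hx => by
      rw [if_pos hx, if_neg fun h => hne' ⟨hx, h⟩, if_neg fun h => hne ⟨hx, h⟩] at this
      omega
    have hy : y = -1 := by
      by_contra hy
      rw [if_neg hx, if_neg hy] at this
      split_ifs at this <;> omega
    have hxy : 1 = x + y := by
      by_contra hxy
      rw [if_neg hx, if_neg hxy] at this
      split_ifs at this <;> omega
    have hx2 : x = 2 := by linear_combination -hxy - hy
    rw [hx2, hy]
    rfl
  -- Outside `0, 1, -1` both candidates survive and are distinct.
  obtain ⟨z, hz⟩ : ∃ z : F, z ∉ ({0, 1, -1} : Finset F) := by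
    by_contra! h
    have h1 := Finset.card_le_card (s := Finset.univ) (t := ({0, 1, -1} : Finset F))
      fun z _ => h z
    rw [Finset.card_univ, hC.card_eq] at h1
    have := h1.trans Finset.card_le_three
    omega
  simp only [Finset.mem_insert, Finset.mem_singleton, not_or] at hz
  obtain ⟨hz0, hz1, hz2⟩ := hz
  have hz3 : z + 1 ≠ 0 := fun h => hz2 (eq_neg_of_add_eq_zero_left h)
  have hz4 : z - 1 ≠ 0 := sub_ne_zero.2 hz1
  have hbasis : ∀ x y : F, x ≠ 0 → x • e + y • g ≠ 0 := fun x y hx h => by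
    have := congrFun h i
    simp [hgi, hei, hx] at this
  have htwo : 2 ≤ {x | x ∈ C ∧ x ≠ 0 ∧ hammingDist (w z) x = q - 2}.ncard := by
    refine (Set.ncard_pair (a := (1 : F) • e + (z - 1) • g)
      (b := (z + 1) • e + (-1 : F) • g) ?_).symm.le.trans ?_
    · intro h
      have := congrFun h i
      simp [hgi, hei, hz0] at this
    · refine Set.ncard_le_ncard ?_ (Set.toFinite _)
      rintro c (rfl | rfl)
      · have h0 := hbasis 1 (z - 1) one_ne_zero
        refine ⟨C.add_mem (C.smul_mem _ he) (C.smul_mem _ hg), h0, ?_⟩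
        have := hdist z _ _ h0
        rw [if_pos rfl, if_neg (c := z - 1 = -1) (by simpa using hz0), if_pos (by ring),
          if_neg one_ne_zero, if_neg hz4, if_neg (by simpa using hz0)] at this
        omega
      · have h0 := hbasis (z + 1) (-1) hz3
        refine ⟨C.add_mem (C.smul_mem _ he) (C.smul_mem _ hg), h0, ?_⟩
        have := hdist z _ _ h0
        rw [if_neg (c := z + 1 = 1) (by simpa using hz0), if_pos rfl, if_pos (by ring),
          if_neg hz3, if_neg (by simp), if_neg (by simpa using hz0)] at this
        omega
  have hsmall : ∀ z : F, z ≠ 0 → ∀ t < q - 2,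
      {x | x ∈ C ∧ x ≠ 0 ∧ hammingDist (w z) x = t}.ncard = 0 := fun z hz t ht => by
    rw [Set.ncard_eq_zero]
    refine Set.eq_empty_of_forall_notMem fun c ⟨hc, h0, hd⟩ => ?_
    have := hge z hz c hc h0
    omega
  refine ⟨w 1, w z, hthree 1 one_ne_zero, hthree z hz0, fun t ht => ?_, ?_⟩
  · rw [numAtDist_eq_ncard_add, numAtDist_eq_ncard_add, hsmall 1 one_ne_zero t ht,
      hsmall z hz0 t ht, hnorm 1 one_ne_zero, hnorm z hz0]
  · rw [numAtDist_eq_ncard_add, numAtDist_eq_ncard_add, hnorm 1 one_ne_zero, hnorm z hz0]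
    omega

lemma not_isCompletelyRegular (hC : IsTwoDimMDS C) (hq : 5 ≤ q) :
    ¬ IsCompletelyRegular (C : Set (Fin (q + 1) → F)) := fun h => by
  obtain ⟨u, v, hu, hv, -, hlt⟩ := hC.exists_numAtDist_lt hq
  exact hlt.ne (h u v (hu.trans hv.symm) (q - 2) (by omega))

lemma not_isUPWS (hC : IsTwoDimMDS C) (hq : 5 ≤ q) (hodd : Odd q) :
    ¬ IsUPWS (C : Set (Fin (q + 1) → F)) := by
  rintro ⟨β, hβ⟩
  rw [hC.coveringRadius_eq hodd] at hβ
  obtain ⟨u, v, -, -, hsmall, hlt⟩ := hC.exists_numAtDist_lt hq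
  have hu := hβ u
  have hv := hβ v
  rw [Finset.sum_range_succ] at hu hv
  rw [Finset.sum_congr rfl fun t ht => by rw [hsmall t (Finset.mem_range.1 ht)]] at hu
  -- The packing identities at `u` and `v` differ only in their last term.
  have hβ0 : β (q - 2) = 0 := by
    have hne : (numAtDist (C : Set (Fin (q + 1) → F)) v (q - 2) : ℚ)
        - numAtDist (C : Set (Fin (q + 1) → F)) u (q - 2) ≠ 0 :=
      sub_ne_zero.2 (mod_cast hlt.ne')
    exact (mul_eq_zero.1 (by linear_combination hv - hu)).resolve_right hne
  obtain ⟨w, hw⟩ := hC.exists_agreement_le_three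
  have hd := le_distToCode_of_agreement_le C hw
  have hw' := hβ w
  rw [Finset.sum_range_succ, hβ0, Finset.sum_eq_zero] at hw'
  · simp at hw'
  · intro t ht
    rw [Finset.mem_range] at ht
    rw [numAtDist_eq_zero_of_lt (by omega)]
    simp

/-! ### Complete regularity for `q = 3` and `q = 4`. -/

/-- The weight distribution of a coset is determined by its values below `q - 1`. -/
lemma numAtDist_eq_of_lt (hC : IsTwoDimMDS C) {u v : Fin (q + 1) → F}
    (h : ∀ t < q - 1, numAtDist (C : Set (Fin (q + 1) → F)) u t
      = numAtDist (C : Set (Fin (q + 1) → F)) v t) {t : ℕ} (ht : t ≤ q + 1) :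
    numAtDist (C : Set (Fin (q + 1) → F)) u t = numAtDist (C : Set (Fin (q + 1) → F)) v t := by
  obtain ⟨m, rfl⟩ : ∃ m, q = m + 1 := ⟨q - 1, by have := hC.two_le; omega⟩
  have u0 := hC.sum_numAtDist u
  have u1 := hC.sum_mul_numAtDist u
  have u2 := hC.sum_sq_mul_numAtDist u
  rw [← hC.sum_numAtDist v] at u0
  rw [← hC.sum_mul_numAtDist v] at u1
  rw [← hC.sum_sq_mul_numAtDist v] at u2
  simp only [Finset.sum_range_succ] at u0 u1 u2
  rw [Finset.sum_congr rfl fun t ht => by rw [h t (Finset.mem_range.1 ht)]] at u1 u2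
  have hs : ∑ t ∈ Finset.range m, numAtDist (C : Set (Fin (m + 1 + 1) → F)) u t =
      ∑ t ∈ Finset.range m, numAtDist (C : Set (Fin (m + 1 + 1) → F)) v t :=
    Finset.sum_congr rfl fun t ht => h t (Finset.mem_range.1 ht)
  rw [hs] at u0
  -- The three unknown counts belong to agreements 2, 1, 0, so the moments of order 0, 1, 2 form an
  -- invertible Vandermonde system.
  have e0 : m + 1 + 1 - m = 2 := by omega
  have e1 : m + 1 + 1 - (m + 1) = 1 := by omega
  simp only [e0, e1, Nat.sub_self] at u1 u2
  rcases Nat.lt_or_ge t m with h' | h'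
  · exact h t h'
  · have : t = m ∨ t = m + 1 ∨ t = m + 2 := by omega
    rcases this with rfl | rfl | rfl <;> omega

end IsTwoDimMDS

namespace IsTwoDimMDS

variable {F : Type*} [Field F] [Fintype F] [DecidableEq F] {q : ℕ}
  {C : Submodule F (Fin (q + 1) → F)}

lemma ncard_eq_zero_of_add_lt (hC : IsTwoDimMDS C) {w : Fin (q + 1) → F} {t : ℕ}
    (h : t + hammingNorm w < q) :
    {x | x ∈ C ∧ x ≠ 0 ∧ hammingDist w x = t}.ncard = 0 := by
  rw [Set.ncard_eq_zero]
  refine Set.eq_empty_of_forall_notMem fun c ⟨hc, h0, hd⟩ => ?_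
  have := hC.le_hammingDist hc C.zero_mem h0 w
  rw [hammingDist_zero_right] at this
  omega

/-- A word of weight two has exactly one nonzero codeword at distance `q - 2`. -/
lemma ncard_weight_two (hC : IsTwoDimMDS C) {w : Fin (q + 1) → F} (hw : hammingNorm w = 2) :
    {x | x ∈ C ∧ x ≠ 0 ∧ hammingDist w x = q - 2}.ncard = 1 := by
  obtain ⟨i, j, hij, hS⟩ := Finset.card_eq_two.1 hw
  have hmem : ∀ l, w l ≠ 0 ↔ l = i ∨ l = j := fun l => by
    simpa using Finset.ext_iff.1 hS l
  have hi : w i ≠ 0 := (hmem i).2 (Or.inl rfl)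
  have hj : w j ≠ 0 := (hmem j).2 (Or.inr rfl)
  have hdist : ∀ c ∈ C, c ≠ 0 → hammingDist w c + ((if w i = c i then 1 else 0) +
      (if w j = c j then 1 else 0)) = q + ((if c i = 0 then 1 else 0) +
      (if c j = 0 then 1 else 0)) := fun c hc h0 => by
    have := hC.hammingDist_add_card hc h0 w {i, j} fun l hl => by
      by_contra h
      exact hl (by simpa using (hmem l).1 h)
    rwa [Finset.card_filter, Finset.card_filter, Finset.sum_pair hij, Finset.sum_pair hij] at this
  have hq := hC.two_le
  obtain ⟨c, hc, hci, hcj⟩ := hC.exists_interpolation hij (w i) (w j)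
  rw [Set.ncard_eq_one]
  refine ⟨c, Set.ext fun x => ⟨?_, ?_⟩⟩
  · rintro ⟨hx, h0, hd⟩
    have := hdist x hx h0
    refine hC.eq_of_eq_of_eq hx hc hij ?_ ?_
    · by_contra h
      rw [if_neg (c := w i = x i) (by rw [← hci]; exact Ne.symm h)] at this
      split_ifs at this <;> omega
    · by_contra h
      rw [if_neg (c := w j = x j) (by rw [← hcj]; exact Ne.symm h)] at this
      split_ifs at this <;> omega
  · rintro rfl
    have h0 : x ≠ 0 := fun h => hi (by rw [← hci, h]; rfl)
    refine ⟨hc, h0, ?_⟩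
    have := hdist x hc h0
    rw [if_pos hci.symm, if_pos hcj.symm, if_neg (by rwa [hci]), if_neg (by rwa [hcj])] at this
    omega

/-- Translating a closest codeword to zero makes the weight equal to the distance, and the moments
supply the values from `q-1` on. -/
lemma isCompletelyRegular_of_forall (hC : IsTwoDimMDS C)
    (h : ∀ u v : Fin (q + 1) → F, hammingNorm u = distToCode u (C : Set (Fin (q + 1) → F)) →
      hammingNorm v = distToCode v (C : Set (Fin (q + 1) → F)) → hammingNorm u = hammingNorm v →
      ∀ t < q - 1, numAtDist (C : Set (Fin (q + 1) → F)) u t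
        = numAtDist (C : Set (Fin (q + 1) → F)) v t) :
    IsCompletelyRegular (C : Set (Fin (q + 1) → F)) := by
  intro u v huv t ht
  obtain ⟨u', hu', hut⟩ := exists_translate C u
  obtain ⟨v', hv', hvt⟩ := exists_translate C v
  have key : ∀ x x' : Fin (q + 1) → F, hammingNorm x' = distToCode x (C : Set (Fin (q + 1) → F)) →
      (∀ t, numAtDist (C : Set (Fin (q + 1) → F)) x' t
        = numAtDist (C : Set (Fin (q + 1) → F)) x t) →
      hammingNorm x' = distToCode x' (C : Set (Fin (q + 1) → F)) := by
    intro x x' hx hxt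
    refine le_antisymm ?_ ((distToCode_le C.zero_mem x').trans_eq (hammingDist_zero_right x'))
    rw [hx]
    by_contra! hlt
    obtain ⟨c, hc, hd⟩ := exists_hammingDist_eq_distToCode (C := (C : Set (Fin (q + 1) → F)))
      ⟨0, C.zero_mem⟩ x'
    have h0 := numAtDist_eq_zero_of_lt hlt
    rw [← hxt, numAtDist, Set.ncard_eq_zero] at h0
    exact Set.notMem_empty c (h0 ▸ ⟨hc, hd⟩)
  rw [← hut, ← hvt]
  exact hC.numAtDist_eq_of_lt
    (h u' v' (key u u' hu' hut) (key v v' hv' hvt) (by rw [hu', hv', huv])) ht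

lemma isCompletelyRegular_of_eq_three (hC : IsTwoDimMDS C) (hq : q = 3) :
    IsCompletelyRegular (C : Set (Fin (q + 1) → F)) := by
  refine hC.isCompletelyRegular_of_forall fun u v hu hv huv t ht => ?_
  have hρ := hC.coveringRadius_le (by rw [hq]; decide)
  have := (distToCode_le_coveringRadius _ u).trans hρ
  rw [numAtDist_eq_ncard_add, numAtDist_eq_ncard_add, hC.ncard_eq_zero_of_add_lt (by omega),
    hC.ncard_eq_zero_of_add_lt (by omega), huv]

lemma isCompletelyRegular_of_eq_four (hC : IsTwoDimMDS C) (hq : q = 4) :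
    IsCompletelyRegular (C : Set (Fin (q + 1) → F)) := by
  refine hC.isCompletelyRegular_of_forall fun u v hu hv huv t ht => ?_
  by_cases h3 : 3 ≤ hammingNorm u
  · rw [numAtDist_eq_zero_of_lt (by omega), numAtDist_eq_zero_of_lt (by omega)]
  rw [numAtDist_eq_ncard_add, numAtDist_eq_ncard_add, huv]
  by_cases hlt : t + hammingNorm u < q
  · rw [hC.ncard_eq_zero_of_add_lt hlt, hC.ncard_eq_zero_of_add_lt (by omega)]
  -- Weight at most 2 and `t ≤ 2` with `t` plus the weight at least 4 leave only weight 2 and `t =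
  -- 2`.
  · obtain rfl : t = q - 2 := by omega
    rw [hC.ncard_weight_two (by omega), hC.ncard_weight_two (by omega)]

lemma isUPWS_of_eq_three (hC : IsTwoDimMDS C) (hq : q = 3) :
    IsUPWS (C : Set (Fin (q + 1) → F)) := by
  have hodd : Odd q := by rw [hq]; decide
  -- The covering radius is 1 and the minimum distance 3, so the code is perfect: each word has
  -- exactly one codeword within distance 1.
  refine ⟨fun _ => 1, fun v => ?_⟩
  obtain ⟨w, hw, hwt⟩ := exists_translate C v
  have := (distToCode_le_coveringRadius _ v).trans (hC.coveringRadius_le hodd)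
  have hρ : coveringRadius (C : Set (Fin (q + 1) → F)) + 1 = 2 := by
    rw [hC.coveringRadius_eq hodd]; omega
  rw [hρ, Finset.sum_range_succ, Finset.sum_range_one, ← hwt, ← hwt, numAtDist_eq_ncard_add,
    numAtDist_eq_ncard_add, hC.ncard_eq_zero_of_add_lt (by omega),
    hC.ncard_eq_zero_of_add_lt (by omega)]
  have : hammingNorm w = 0 ∨ hammingNorm w = 1 := by omega
  rcases this with h | h <;> simp only [h] <;> norm_num

end IsTwoDimMDS

theorem mainTheorem5 {F : Type*} [Field F] [Fintype F] [DecidableEq F] (q : ℕ)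
    (hq : Fintype.card F = q) (C : Submodule F (Fin (q + 1) → F))
    (hC : IsLinearCode C 2 q) (hMDS : IsMDS C) :
    (Odd q →
      (IsUPWS (C : Set (Fin (q + 1) → F)) ↔ q = 3) ∧
      (IsCompletelyRegular (C : Set (Fin (q + 1) → F)) ↔ q = 3)) ∧
    (Even q → IsUPWS (C : Set (Fin (q + 1) → F))) ∧
    (q = 4 → IsCompletelyRegular (C : Set (Fin (q + 1) → F))) ∧
    (q = 8 → ¬ IsCompletelyRegular (C : Set (Fin (q + 1) → F))) := by
  have h := hC.isTwoDimMDS hq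
  have h2 := h.two_le
  refine ⟨fun hodd => ?_, h.isUPWS_of_even, h.isCompletelyRegular_of_eq_four,
    fun h8 => h.not_isCompletelyRegular (by omega)⟩
  have hcases : q ≠ 3 → 5 ≤ q := fun h3 => by
    obtain ⟨m, rfl⟩ := hodd
    omega
  refine ⟨⟨fun hU => ?_, h.isUPWS_of_eq_three⟩, ⟨fun hR => ?_, h.isCompletelyRegular_of_eq_three⟩⟩
  · by_contra h3
    exact h.not_isUPWS (hcases h3) hodd hU
  · by_contra h3
    exact h.not_isCompletelyRegular (hcases h3) hR
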